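/- For $f:\mathbb{Z}\to\mathbb{R}$ and $k\ge 1$ let $f^{(k)}(n)=\sum_{j=0}^{k}\binom{k}{j}(-1)^{j}f(n+k-j)$ be the $k$-th discrete derivative. For a finite set $A\subset\mathbb{Z}$ let $\chi_A$ be its characteristic function and let $\partial_l A=\{n\in A: n-1\notin A\}$ be its left boundary. For $1\le p\le\infty$ let $p'$ be the dual exponent, $\frac1p+\frac1{p'}=1$ (with $1/\infty=0$). (i) For every integer $N\ge 1$ there is $K$, depending only on $N$, such that for every finite set $A\subset\mathbb{Z}$ with $|A|=N$, every $1\le p\le\infty$ and every $k\ge K$, $$\|\chi_A^{(k)}\|_{l^p(\mathbb{Z})}\ \ge\ 2^{\,k-1-\frac{|A|-1}{2}\log_2 (2k)}\Big(\frac{\sqrt{|A|-1}}{7\pi e^{3/2}}\Big)^{|A|-1}(k+1)^{-\frac1{p'}}\,|A|^{\frac1p}.$$ (ii) For every integer $M\ge 1$ there is $K$, depending only on $M$, such that for every finite nonempty set $A\subset\mathbb{Z}$ with $|\partial_l A|=M$, every $1\le p\le\infty$ and every $k\ge K$, $$\|\chi_A^{(k+1)}\|_{l^p(\mathbb{Z})}\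 \ge\ 2^{\,k-1-\frac{2|\partial_l A|-1}{2}\log_2 (2k)}\Big(\frac{\sqrt{2|\partial_l A|-1}}{7\pi e^{3/2}}\Big)^{2|\partial_l A|-1}(k+1)^{-\frac1{p'}}\,\big(2|\partial_l A|\big)^{\frac1p}.$$ For $|A|=1$ the factor $\big(\sqrt{|A|-1}/(7\pi e^{3/2})\big)^{|A|-1}=0^0$ in (i) is read as $1$. -/

import Mathlib

open MeasureTheory
open scoped ENNReal

noncomputable section

/-- The `k`-th discrete derivative (iterated forward difference)
`f⁽ᵏ⁾(n) = ∑_{j=0}^k (k choose j) (-1)^j f(n+k-j)` of a function on the integers. -/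
def discreteDeriv (k : ℕ) (f : ℤ → ℝ) (n : ℤ) : ℝ :=
  ∑ j ∈ Finset.range (k + 1), (k.choose j : ℝ) * (-1) ^ j * f (n + (k : ℤ) - (j : ℤ))

/-- The characteristic function of a finite set of integers. -/
def charFn (A : Finset ℤ) : ℤ → ℝ :=
  Set.indicator (A : Set ℤ) (fun _ => (1 : ℝ))

/-- The left boundary of `A`: the points `n` of `A` with `n - 1 ∉ A`. -/
def leftBoundary (A : Finset ℤ) : Finset ℤ :=
  A.filter (fun n => n - 1 ∉ A)

/-- The `ℓᵖ(ℤ)` norm, `1 ≤ p ≤ ∞`, as an extended nonnegative real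
(the `Lᵖ` norm for counting measure on the integers). -/
def ellNorm (p : ℝ≥0∞) (f : ℤ → ℝ) : ℝ≥0∞ :=
  eLpNorm f p (Measure.count : Measure ℤ)

end

/-! On the Fourier side the `k`-th difference of `g` is multiplied by `(w⁻¹ - 1) ^ k`, of modulus
close to `2 ^ k` near `w = -1`. Hence the `ℓ¹` norm is at least about `2 ^ k` times any value of the
exponential sum `G(t) = ∑ g(a) e^{-iat}` taken at a frequency close to `π`.

It remains to see that `G` is not tiny near `π`. Some `|G(t)|` is at least 1, because the
coefficients of `G` are its Fourier means. Along a progression from `t` that reaches `π` in `M + 1`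
steps, `G` is a sum of `|S|` unimodular powers, so Turán's theorem (`norm_sum_le_of_window`)
transfers the bound 1 to one of `|S|` consecutive points starting at `π`, at the price of a binomial
coefficient. Taking `M` of order `√(mk)`, with `m = |S| - 1`, balances this price against the decay
of `|w⁻¹ - 1| ^ k` away from `π`.

Hölder on the support, of size at most `|S| (k + 1)`, passes from `ℓ¹` to `ℓᵖ`. Everything is proved
for a general `g` in `ofReal_le_ellNorm_discreteDeriv`; (i) takes `g = χ_A`, and (ii) takes its
first difference, which lives on the `2|∂_l A|` jumps of `A`. -/

/-! ### Turán's first main theorem. -/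

theorem one_add_sum_range_choose (r M : ℕ) :
    1 + ∑ j ∈ Finset.range (M + 1), (j + r + 1).choose r = (M + r + 2).choose (r + 1) := by
  induction M with
  | zero =>
    simp only [zero_add, Finset.sum_range_one, Nat.choose_succ_succ' (r + 1) r, Nat.choose_self]
    omega
  | succ M ih =>
    rw [Finset.sum_range_succ, ← add_assoc, ih,
      show M + 1 + r + 2 = (M + r + 2) + 1 by ring, Nat.choose_succ_succ' (M + r + 2) r,
      show M + 1 + r + 1 = M + r + 2 by ring]
    omega

/-- Turán's first main theorem, for unimodular nodes. -/
theorem norm_sum_le_of_window {ι : Type*} [DecidableEq ι] (S : Finset ι) (hS : S.Nonempty)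
    (z : ι → ℂ) (hz : ∀ i, ‖z i‖ = 1) (b : ι → ℂ) (M : ℕ) (C : ℝ)
    (h : ∀ q, M + 1 ≤ q → q ≤ M + S.card → ‖∑ i ∈ S, b i * z i ^ q‖ ≤ C) :
    ‖∑ i ∈ S, b i‖ ≤ 2 ^ (S.card - 1) * ((M + S.card).choose (S.card - 1) : ℝ) * C := by
  induction hS using Finset.Nonempty.cons_induction generalizing b M C with
  | singleton a => simpa [hz] using h (M + 1) le_rfl (by simp)
  | cons a S ha hS ih =>
    obtain ⟨r, hr⟩ : ∃ r, S.card = r + 1 := ⟨S.card - 1, by have := hS.card_pos; omega⟩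
    rw [Finset.card_cons, hr] at h ⊢
    set s : ℕ → ℂ := fun q => ∑ i ∈ Finset.cons a S ha, b i * z i ^ q with hs
    have hC : 0 ≤ C := (norm_nonneg _).trans (h (M + 1) le_rfl (by omega))
    -- The twisted difference eliminates the node `z a`, leaving a power sum over `S` to which
    -- induction applies.
    have hu : ∀ j, ∑ i ∈ S, b i * (z i - z a) * z i ^ j = s (j + 1) - z a * s j := by
      intro j
      simp only [hs, Finset.sum_cons, mul_add, Finset.mul_sum]
      rw [add_sub_add_comm, ← Finset.sum_sub_distrib]
      rw [show b a * z a ^ (j + 1) - z a * (b a * z a ^ j) = 0 by ring, zero_add]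
      exact Finset.sum_congr rfl fun i _ => by ring
    have hbound : ∀ j ∈ Finset.range (M + 1), ‖∑ i ∈ S, b i * (z i - z a) * z i ^ j‖ ≤
        2 ^ (r + 1) * (((M - j) + r + 1).choose r : ℝ) * C := by
      intro j hj
      have hj' : j ≤ M := by simpa [Nat.lt_succ_iff] using hj
      -- Absorbing `z i ^ j` into the coefficients shortens the gap before the window to `M - j`;
      -- each value is a difference of two values of `s` in the original window, hence the bound `2
      -- * C`.
      have := ih (fun i => b i * (z i - z a) * z i ^ j) (M - j) (2 * C) (by
        intro q h1 h2
        rw [hr] at h2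
        simp only [mul_assoc _ (z _ ^ j), ← pow_add, hu]
        calc ‖s (j + q + 1) - z a * s (j + q)‖ ≤ ‖s (j + q + 1)‖ + ‖z a * s (j + q)‖ :=
              norm_sub_le _ _
          _ ≤ C + C := by
              rw [norm_mul, hz, one_mul]
              exact add_le_add (h _ (by omega) (by omega)) (h _ (by omega) (by omega))
          _ = 2 * C := by ring)
      rw [hr] at this
      refine this.trans (le_of_eq ?_)
      simp only [Nat.add_sub_cancel, ← add_assoc]
      ring
    -- As `|z a| = 1`, the twisted differences telescope in norm; the resulting binomials add up by
    -- the hockey-stick identity.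
    have htel : ∀ L, ‖s 0‖ ≤ ‖s L‖ +
        ∑ j ∈ Finset.range L, ‖∑ i ∈ S, b i * (z i - z a) * z i ^ j‖ := by
      intro L
      induction L with
      | zero => simp
      | succ L ihL =>
        rw [Finset.sum_range_succ]
        have : ‖s L‖ ≤ ‖s (L + 1)‖ + ‖∑ i ∈ S, b i * (z i - z a) * z i ^ L‖ := by
          rw [hu]
          calc ‖s L‖ = ‖z a * s L‖ := by rw [norm_mul, hz, one_mul]
            _ = ‖s (L + 1) - (s (L + 1) - z a * s L)‖ := by rw [sub_sub_cancel]
            _ ≤ _ := norm_sub_le _ _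
        linarith
    have h0 : ∑ i ∈ Finset.cons a S ha, b i = s 0 := by simp [hs]
    rw [h0]
    have hsum : ∑ j ∈ Finset.range (M + 1), (((M - j) + r + 1).choose r : ℝ) =
        ∑ j ∈ Finset.range (M + 1), ((j + r + 1).choose r : ℝ) := by
      rw [← Finset.sum_range_reflect]
      exact Finset.sum_congr rfl fun j hj => by
        have : j ≤ M := by simpa [Nat.lt_succ_iff] using hj
        rw [show M - (M + 1 - 1 - j) = j by omega]
    have hchoose : ((M + (r + 1 + 1)).choose (r + 1 + 1 - 1) : ℝ) =
        1 + ∑ j ∈ Finset.range (M + 1), ((j + r + 1).choose r : ℝ) := by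
      rw [show M + (r + 1 + 1) = M + r + 2 by ring, Nat.add_sub_cancel,
        ← one_add_sum_range_choose]
      push_cast; rfl
    calc ‖s 0‖ ≤ ‖s (M + 1)‖ + _ := htel (M + 1)
      _ ≤ 2 ^ (r + 1) * C + ∑ j ∈ Finset.range (M + 1),
            2 ^ (r + 1) * (((M - j) + r + 1).choose r : ℝ) * C := by
          refine add_le_add ((h _ le_rfl (by omega)).trans ?_) (Finset.sum_le_sum hbound)
          exact le_mul_of_one_le_left hC (one_le_pow₀ (by norm_num))
      _ = _ := by
          rw [hchoose, ← hsum, ← Finset.sum_mul, ← Finset.mul_sum, Nat.add_sub_cancel]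
          ring

/-! ### A binomial bound, and a frequency where an exponential sum is large. -/

theorem choose_le_exp_mul_div_pow (n m : ℕ) :
    (n.choose m : ℝ) ≤ (Real.exp 1 * n / m) ^ m := by
  rcases Nat.eq_zero_or_pos m with rfl | hm
  · simp
  have hm' : (0 : ℝ) < m := by exact_mod_cast hm
  have h1 : (m : ℝ) ^ m / m.factorial ≤ Real.exp 1 ^ m := by
    rw [← Real.exp_nat_mul, mul_one]
    exact Real.pow_div_factorial_le_exp _ hm'.le _
  calc (n.choose m : ℝ) ≤ n ^ m / m.factorial := Nat.choose_le_pow_div m n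
    _ = (n / m : ℝ) ^ m * (m ^ m / m.factorial) := by
        rw [div_pow]; field_simp
    _ ≤ (n / m : ℝ) ^ m * Real.exp 1 ^ m := by gcongr
    _ = _ := by rw [← mul_pow]; ring

/-- The coefficient `c n` is the mean of the sum against `e^{int}` over a period, so it cannot
exceed the maximum modulus. -/
theorem exists_one_le_norm_sum_exp (S : Finset ℤ) (c : ℤ → ℂ) {n : ℤ} (hn : n ∈ S)
    (hc : 1 ≤ ‖c n‖) :
    ∃ t ∈ Set.Icc 0 (2 * Real.pi), 1 ≤ ‖∑ a ∈ S, c a * Complex.exp (-(Complex.I * t)) ^ a‖ := by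
  set G : ℝ → ℂ := fun t => ∑ a ∈ S, c a * Complex.exp (-(Complex.I * t)) ^ a with hG
  have hGc : Continuous G := by
    refine continuous_finsetSum _ fun a _ => continuous_const.mul ?_
    exact Continuous.zpow₀ (by fun_prop) _ fun t => Or.inl (Complex.exp_ne_zero _)
  have hpi := Real.pi_pos
  obtain ⟨t, ht, hmax⟩ := isCompact_Icc.exists_isMaxOn
    (Set.nonempty_Icc.2 (by positivity : (0 : ℝ) ≤ 2 * Real.pi)) hGc.norm.continuousOn
  refine ⟨t, ht, ?_⟩
  have hterm : ∀ a : ℤ, ∫ t in (0 : ℝ)..(2 * Real.pi),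
      c a * Complex.exp (((n - a : ℤ) * Complex.I) * t) =
        if a = n then 2 * Real.pi * c n else 0 := by
    intro a
    split_ifs with h
    · subst h
      simp [mul_comm]
    · have h' : ((n - a : ℤ) * Complex.I) ≠ 0 :=
        mul_ne_zero (by exact_mod_cast sub_ne_zero.2 (Ne.symm h)) Complex.I_ne_zero
      rw [intervalIntegral.integral_const_mul, integral_exp_mul_complex h']
      have : Complex.exp (((n - a : ℤ) * Complex.I) * ((2 * Real.pi : ℝ) : ℂ)) = 1 := by
        rw [Complex.exp_eq_one_iff]
        exact ⟨n - a, by push_cast; ring⟩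
      rw [this]
      simp
  have hint : ∫ t in (0 : ℝ)..(2 * Real.pi), G t * Complex.exp (Complex.I * n * t) =
      2 * Real.pi * c n := by
    have : ∀ t : ℝ, G t * Complex.exp (Complex.I * n * t) =
        ∑ a ∈ S, c a * Complex.exp (((n - a : ℤ) * Complex.I) * t) := by
      intro t
      rw [hG, Finset.sum_mul]
      refine Finset.sum_congr rfl fun a _ => ?_
      rw [← Complex.exp_int_mul, mul_assoc, ← Complex.exp_add]
      congr 2
      push_cast
      ring
    simp only [this]
    rw [intervalIntegral.integral_finsetSum]
    · simp only [hterm, Finset.sum_ite_eq', hn, if_true]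
    · intro a _
      exact Continuous.intervalIntegrable (by fun_prop) _ _
  have hle := intervalIntegral.norm_integral_le_of_norm_le_const (a := 0) (b := 2 * Real.pi)
    (f := fun t : ℝ => G t * Complex.exp (Complex.I * n * t)) (C := ‖G t‖) (by
      intro x hx
      rw [Set.uIoc_of_le (by positivity)] at hx
      have : ‖Complex.exp (Complex.I * n * x)‖ = 1 := by
        rw [show Complex.I * n * x = ((n * x : ℝ) : ℂ) * Complex.I by push_cast; ring]
        exact Complex.norm_exp_ofReal_mul_I _
      rw [norm_mul, this, mul_one]
      exact hmax ⟨hx.1.le, hx.2⟩)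
  rw [hint, sub_zero, abs_of_pos (by positivity), norm_mul, norm_mul, Complex.norm_real,
    Real.norm_of_nonneg hpi.le, Complex.norm_ofNat, mul_comm] at hle
  have := le_of_mul_le_mul_right hle (by positivity)
  exact hc.trans this

/-! ### Discrete derivatives on the Fourier side. -/

theorem discreteDeriv_eq_fwdDiff_iter (k : ℕ) (f : ℤ → ℝ) :
    discreteDeriv k f = (fwdDiff (1 : ℤ))^[k] f := by
  ext n
  rw [fwdDiff_iter_eq_sum_shift, discreteDeriv, ← Finset.sum_range_reflect]
  refine Finset.sum_congr rfl fun j hj => ?_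
  have hj' : j ≤ k := by simpa [Nat.lt_succ_iff] using hj
  rw [show k + 1 - 1 - j = k - j by omega, Nat.choose_symm hj', zsmul_eq_mul, Nat.cast_sub hj']
  rw [show n + (k : ℤ) - ((k : ℤ) - (j : ℤ)) = n + j • (1 : ℤ) by simp; ring]
  push_cast
  ring

theorem discreteDeriv_succ (k : ℕ) (f : ℤ → ℝ) :
    discreteDeriv (k + 1) f = discreteDeriv k (fwdDiff 1 f) := by
  simp only [discreteDeriv_eq_fwdDiff_iter, Function.iterate_succ_apply]

/-- The set of points at which the `k`-th discrete derivative of a function supported on `S` may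
be nonzero. -/
def derivSupport (k : ℕ) (S : Finset ℤ) : Finset ℤ :=
  (S ×ˢ Finset.range (k + 1)).image fun x => x.1 - k + x.2

theorem card_derivSupport_le (k : ℕ) (S : Finset ℤ) :
    (derivSupport k S).card ≤ S.card * (k + 1) :=
  Finset.card_image_le.trans (by simp)

theorem support_discreteDeriv_subset (k : ℕ) {S : Finset ℤ} {g : ℤ → ℝ}
    (hg : Function.support g ⊆ S) :
    Function.support (discreteDeriv k g) ⊆ derivSupport k S := by
  intro n hn
  obtain ⟨j, hj, hne⟩ := Finset.exists_ne_zero_of_sum_ne_zero hn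
  refine Finset.mem_coe.2 (Finset.mem_image.2 ⟨(n + k - j, j), ?_, by simp only; ring⟩)
  exact Finset.mem_product.2 ⟨hg (right_ne_zero_of_mul hne), hj⟩

theorem tsum_fwdDiff_mul_zpow {g : ℤ → ℝ} (hg : (Function.support g).Finite) {w : ℂ}
    (hw : w ≠ 0) :
    ∑' n, ((fwdDiff 1 g n : ℝ) : ℂ) * w ^ n = (w⁻¹ - 1) * ∑' n, (g n : ℂ) * w ^ n := by
  have hs : Summable fun n : ℤ => (g n : ℂ) * w ^ n :=
    summable_of_hasFiniteSupport (hg.subset fun n hn => by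
      have := left_ne_zero_of_mul hn
      simpa using this)
  have hs' : Summable fun n : ℤ => w⁻¹ * ((g (n + 1) : ℂ) * w ^ (n + 1)) :=
    ((Equiv.addRight (1 : ℤ)).summable_iff.2 hs).mul_left _
  have h : ∀ n, ((fwdDiff 1 g n : ℝ) : ℂ) * w ^ n =
      w⁻¹ * ((g (n + 1) : ℂ) * w ^ (n + 1)) - (g n : ℂ) * w ^ n := by
    intro n
    rw [zpow_add_one₀ hw, fwdDiff]
    push_cast
    field_simp
  simp only [h]
  have hshift : ∑' n : ℤ, (g (n + 1) : ℂ) * w ^ (n + 1) = ∑' n : ℤ, (g n : ℂ) * w ^ n :=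
    (Equiv.addRight (1 : ℤ)).tsum_eq fun n : ℤ => (g n : ℂ) * w ^ n
  rw [hs'.tsum_sub hs, tsum_mul_left, hshift]
  ring

theorem tsum_discreteDeriv_mul_zpow (k : ℕ) {g : ℤ → ℝ} (hg : (Function.support g).Finite)
    {w : ℂ} (hw : w ≠ 0) :
    ∑' n, (discreteDeriv k g n : ℂ) * w ^ n = (w⁻¹ - 1) ^ k * ∑' n, (g n : ℂ) * w ^ n := by
  induction k with
  | zero => simp [discreteDeriv_eq_fwdDiff_iter]
  | succ k ih =>
    have hk : (Function.support (discreteDeriv k g)).Finite :=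
      (Finset.finite_toSet _).subset
        (support_discreteDeriv_subset k (S := hg.toFinset) (by simp))
    have : discreteDeriv (k + 1) g = fwdDiff 1 (discreteDeriv k g) := by
      simp only [discreteDeriv_eq_fwdDiff_iter, Function.iterate_succ_apply']
    rw [this, tsum_fwdDiff_mul_zpow hk hw, ih, pow_succ]
    ring

theorem norm_pow_mul_norm_sum_le (k : ℕ) {S : Finset ℤ} {g : ℤ → ℝ}
    (hg : Function.support g ⊆ S) {w : ℂ} (hw : ‖w‖ = 1) :
    ‖w⁻¹ - 1‖ ^ k * ‖∑ a ∈ S, (g a : ℂ) * w ^ a‖ ≤ ∑' n, ‖discreteDeriv k g n‖ := by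
  have hw0 : w ≠ 0 := norm_ne_zero_iff.1 (by rw [hw]; exact one_ne_zero)
  have hG : ∑' n, (g n : ℂ) * w ^ n = ∑ a ∈ S, (g a : ℂ) * w ^ a :=
    tsum_eq_sum fun n hn => by
      have : g n = 0 := by
        by_contra h
        exact hn (hg h)
      simp [this]
  rw [← hG, ← norm_pow, ← norm_mul,
    ← tsum_discreteDeriv_mul_zpow k ((Finset.finite_toSet S).subset hg) hw0]
  have hnorm : ∀ n : ℤ, ‖(discreteDeriv k g n : ℂ) * w ^ n‖ = ‖discreteDeriv k g n‖ := by
    intro n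
    rw [norm_mul, norm_zpow, hw, one_zpow, mul_one, Complex.norm_real]
  simp only [← hnorm]
  refine norm_tsum_le_tsum_norm ?_
  simp only [hnorm]
  exact summable_of_hasFiniteSupport (((Finset.finite_toSet _).subset
    (support_discreteDeriv_subset k hg)).subset fun n hn => by simpa using hn)

/-! ### From `ℓ¹` to `ℓᵖ`. -/

theorem ellNorm_one_eq_ofReal_tsum {f : ℤ → ℝ} (hf : (Function.support f).Finite) :
    ellNorm 1 f = ENNReal.ofReal (∑' n, ‖f n‖) := by
  rw [ellNorm, eLpNorm_one_eq_lintegral_enorm, lintegral_count,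
    ENNReal.ofReal_tsum_of_nonneg (fun n => norm_nonneg _)
      (summable_of_hasFiniteSupport (hf.subset fun n hn => by simpa using hn))]
  simp only [ofReal_norm]

theorem toReal_one_div_add {p p' : ℝ≥0∞} (h : p.HolderConjugate p') :
    (1 / p).toReal + (1 / p').toReal = 1 := by
  have h1 := ENNReal.holderConjugate_iff.1 h
  have hp : p⁻¹ ≠ ∞ := ne_top_of_le_ne_top ENNReal.one_ne_top (h1 ▸ le_self_add)
  have hp' : p'⁻¹ ≠ ∞ := ne_top_of_le_ne_top ENNReal.one_ne_top (h1 ▸ le_add_self)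
  rw [one_div, one_div, ← ENNReal.toReal_add hp hp', h1, ENNReal.toReal_one]

theorem ellNorm_one_le_ellNorm_mul_card {f : ℤ → ℝ} {T : Finset ℤ}
    (hf : Function.support f ⊆ T) {p p' : ℝ≥0∞} (hp : 1 ≤ p) (h : p.HolderConjugate p') :
    ellNorm 1 f ≤ ellNorm p f * (T.card : ℝ≥0∞) ^ (1 / p').toReal := by
  have := eLpNorm_le_eLpNorm_mul_rpow_measure_univ hp
    (μ := (Measure.count : Measure ℤ).restrict (T : Set ℤ)) (f := f)
    (measurable_from_top (f := f)).aestronglyMeasurable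
  rw [eLpNorm_restrict_eq_of_support_subset hf, eLpNorm_restrict_eq_of_support_subset hf,
    Measure.restrict_apply_univ, Measure.count_apply_finset] at this
  have he : 1 / (1 : ℝ≥0∞).toReal - 1 / p.toReal = (1 / p').toReal := by
    have h2 := toReal_one_div_add h
    rw [ENNReal.toReal_div] at h2
    simp only [ENNReal.toReal_one, div_one] at h2 ⊢
    linarith
  rwa [he] at this

theorem ofReal_le_ellNorm_of_mul_card_le {f : ℤ → ℝ} {T : Finset ℤ}
    (hf : Function.support f ⊆ T) {N k : ℕ} (hN : 0 < N) (hT : T.card ≤ N * (k + 1))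
    {p p' : ℝ≥0∞} (hp : 1 ≤ p) (h : p.HolderConjugate p') {R : ℝ}
    (hR : R * N ≤ ∑' n, ‖f n‖) :
    ENNReal.ofReal (R * ((k : ℝ) + 1) ^ (-(1 / p').toReal) * (N : ℝ) ^ (1 / p).toReal) ≤
      ellNorm p f := by
  set s := (1 / p').toReal with hs
  have hs0 : 0 ≤ s := ENNReal.toReal_nonneg
  have hN' : (0 : ℝ) < N := by exact_mod_cast hN
  have hk : (0 : ℝ) < (k : ℝ) + 1 := by positivity
  have hcast : ((N * (k + 1) : ℕ) : ℝ≥0∞) ^ s = ENNReal.ofReal ((N * (k + 1) : ℝ) ^ s) := by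
    rw [← ENNReal.ofReal_rpow_of_pos (by positivity), ← ENNReal.ofReal_natCast]
    push_cast
    rfl
  have h1 : ENNReal.ofReal (R * N) ≤ ellNorm p f * ENNReal.ofReal ((N * (k + 1) : ℝ) ^ s) := by
    rw [← hcast]
    calc ENNReal.ofReal (R * N) ≤ ENNReal.ofReal (∑' n, ‖f n‖) := ENNReal.ofReal_le_ofReal hR
      _ = ellNorm 1 f :=
          (ellNorm_one_eq_ofReal_tsum ((Finset.finite_toSet T).subset hf)).symm
      _ ≤ ellNorm p f * (T.card : ℝ≥0∞) ^ s := ellNorm_one_le_ellNorm_mul_card hf hp h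
      _ ≤ _ := by gcongr
  -- The factor `N` in `R * N` combines with `N ^ (-s)` from Hölder into `N ^ (1/p)`.
  have h2 : R * ((k : ℝ) + 1) ^ (-s) * (N : ℝ) ^ (1 / p).toReal =
      R * N / (N * (k + 1) : ℝ) ^ s := by
    have : (1 / p).toReal = 1 - s := by linarith [toReal_one_div_add h]
    rw [this, Real.rpow_sub hN', Real.rpow_one, Real.rpow_neg hk.le,
      Real.mul_rpow hN'.le hk.le]
    field_simp
  rw [h2, ENNReal.ofReal_div_of_pos (by positivity)]
  exact ENNReal.div_le_of_le_mul h1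

/-! ### Numerical estimates near frequency `π`. -/

theorem two_mul_one_sub_le_norm_exp_sub_one (x : ℝ) :
    2 * (1 - (x - Real.pi) ^ 2 / 8) ≤ ‖(Complex.exp (-(Complex.I * x)))⁻¹ - 1‖ := by
  rw [← Complex.exp_neg, neg_neg, Complex.norm_exp_I_mul_ofReal_sub_one, norm_mul,
    Real.norm_ofNat]
  have h : Real.sin (x / 2) = Real.cos ((x - Real.pi) / 2) := by
    rw [← Real.cos_pi_div_two_sub, ← Real.cos_neg]
    congr 1
    ring
  have h2 := Real.one_sub_sq_div_two_le_cos (x := (x - Real.pi) / 2)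
  have h3 := le_abs_self (Real.cos ((x - Real.pi) / 2))
  rw [h, Real.norm_eq_abs]
  nlinarith

/-- For `0 ≤ x ≤ 1/2`, `(1 - x)(1 + 2x) ≥ 1` gives `e^{-2x} ≤ 1 - x`; take `x = m/(2k)` and raise to
the power `k`. -/
theorem exp_neg_le_one_sub_pow {m k : ℕ} (hk : 0 < k) (hmk : m ≤ k) :
    Real.exp (-m) ≤ (1 - (m : ℝ) / (2 * k)) ^ k := by
  have hk' : (0 : ℝ) < k := by exact_mod_cast hk
  have hmk' : (m : ℝ) ≤ k := by exact_mod_cast hmk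
  set x : ℝ := (m : ℝ) / (2 * k) with hx
  have hx0 : 0 ≤ x := by positivity
  have hx1 : x ≤ 1 / 2 := by
    rw [hx, div_le_iff₀ (by positivity)]
    linarith
  have h : Real.exp (-(2 * x)) ≤ 1 - x := by
    rw [Real.exp_neg, inv_le_iff_one_le_mul₀ (Real.exp_pos _)]
    have := Real.add_one_le_exp (2 * x)
    nlinarith
  calc Real.exp (-m) = Real.exp (-(2 * x)) ^ k := by
        rw [← Real.exp_nat_mul]
        congr 1
        rw [hx]
        field_simp
    _ ≤ _ := pow_le_pow_left₀ (Real.exp_pos _).le h k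

/-- This is where the constant `7π e^{3/2}` is shown to suffice: one node's share of the claimed
bound, times its Turán and exponential losses, is at most 1 with a factor 2 to spare. Numerically,
`6.6 (π/2 + 2) ≤ 1.4 · 7π`. -/
theorem two_mul_ratio_mul_le_one {m k Q : ℝ} (hm : 1 ≤ m) (hk : 0 < k)
    (hQ : Q ≤ (Real.pi / 2 + 2) * Real.sqrt (m * k)) :
    2 * (1 / Real.sqrt (2 * k) * (Real.sqrt m / (7 * Real.pi * Real.exp (3 / 2)))) *
      (2 * Real.exp 2 * Q / m) ≤ 1 := by
  have he : Real.exp 2 = Real.exp (3 / 2) * Real.exp (1 / 2) := by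
    rw [← Real.exp_add]
    norm_num
  have he1 : Real.exp (1 / 2) ≤ 1.65 := by
    have h1 : Real.exp (1 / 2) ^ 2 = Real.exp 1 := by
      rw [← Real.exp_nat_mul]
      norm_num
    refine le_of_not_gt fun hlt => ?_
    nlinarith [Real.exp_one_lt_d9]
  have h2 : (1.4 : ℝ) ≤ Real.sqrt 2 := Real.le_sqrt_of_sq_le (by norm_num)
  have hpi := Real.pi_gt_three
  have hsm : 0 < Real.sqrt m := Real.sqrt_pos.2 (by linarith)
  have hsk : 0 < Real.sqrt k := Real.sqrt_pos.2 hk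
  have hm2 : Real.sqrt m * Real.sqrt m = m := Real.mul_self_sqrt (by linarith)
  have hee := Real.exp_pos (3 / 2)
  have hee' := Real.exp_pos (1 / 2)
  rw [Real.sqrt_mul (by linarith)] at hQ
  have heq : 2 * (1 / Real.sqrt (2 * k) * (Real.sqrt m / (7 * Real.pi * Real.exp (3 / 2)))) *
      (2 * Real.exp 2 * Q / m) =
      4 * Real.exp (1 / 2) * Q / (Real.sqrt m * Real.sqrt k * (Real.sqrt 2 * (7 * Real.pi))) := by
    rw [Real.sqrt_mul (by norm_num), he]
    nth_rewrite 2 [← hm2]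
    field_simp
    ring
  rw [heq, div_le_one (by positivity)]
  calc 4 * Real.exp (1 / 2) * Q
      ≤ 4 * 1.65 * ((Real.pi / 2 + 2) * (Real.sqrt m * Real.sqrt k)) := by
        have : 0 ≤ (Real.pi / 2 + 2) * (Real.sqrt m * Real.sqrt k) := by positivity
        nlinarith
    _ = Real.sqrt m * Real.sqrt k * (6.6 * (Real.pi / 2 + 2)) := by ring
    _ ≤ _ := by
        refine mul_le_mul_of_nonneg_left ?_ (by positivity)
        nlinarith [mul_nonneg (sub_nonneg.2 h2) (sub_nonneg.2 hpi.le)]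

/-! ### The lower bound for a general finitely supported function. -/

theorem ofReal_le_ellNorm_discreteDeriv {S : Finset ℤ} {g : ℤ → ℝ}
    (hg : Function.support g ⊆ S) {n : ℤ} (hn : n ∈ S) (hgn : 1 ≤ |g n|)
    {p p' : ℝ≥0∞} (hp : 1 ≤ p) (h : p.HolderConjugate p') {k : ℕ} (hk : S.card ≤ k) :
    ENNReal.ofReal
      ((2 : ℝ) ^ ((k : ℝ) - 1 - ((S.card : ℝ) - 1) / 2 * Real.logb 2 (2 * (k : ℝ))) *
        (Real.sqrt ((S.card : ℝ) - 1) / (7 * Real.pi * Real.exp (3 / 2))) ^ (S.card - 1) *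
        ((k : ℝ) + 1) ^ (-(1 / p').toReal) *
        (S.card : ℝ) ^ (1 / p).toReal)
      ≤ ellNorm p (discreteDeriv k g) := by
  have hS : S.Nonempty := ⟨n, hn⟩
  refine ofReal_le_ellNorm_of_mul_card_le (support_discreteDeriv_subset k hg) hS.card_pos
    (card_derivSupport_le k S) hp h ?_
  obtain ⟨m, hm⟩ : ∃ m, S.card = m + 1 := ⟨S.card - 1, by have := hS.card_pos; omega⟩
  rw [hm] at hk ⊢
  have hk0 : 0 < k := by omega
  have hk' : (0 : ℝ) < k := by exact_mod_cast hk0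
  have hmk : (m : ℝ) + 1 ≤ k := by exact_mod_cast hk
  have hpi := Real.pi_pos
  set L : ℝ := ∑' n, ‖discreteDeriv k g n‖ with hL
  have hL0 : 0 ≤ L := tsum_nonneg fun _ => norm_nonneg _
  obtain ⟨t, ht, htG⟩ := exists_one_le_norm_sum_exp S (fun a => (g a : ℂ)) hn
    (by simpa using hgn)
  -- With this `M`, every point of the window is within `mπ/(M + 1) ≤ 2√(m/k)` of `π`, so `(x -
  -- π)²/8 ≤ m/(2k)`.
  set M : ℕ := ⌊Real.pi * Real.sqrt (m * k) / 2⌋₊ with hM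
  have hM1 : Real.pi * Real.sqrt (m * k) / 2 < M + 1 := Nat.lt_floor_add_one _
  have hM2 : (M : ℝ) ≤ Real.pi * Real.sqrt (m * k) / 2 := Nat.floor_le (by positivity)
  -- The progression `t + qθ` hits `π` exactly at `q = M + 1`, the first index of Turán's window.
  set θ : ℝ := (Real.pi - t) / (M + 1) with hθ
  set C : ℝ := L / (2 ^ k * Real.exp (-m)) with hC
  have hwindow : ∀ q : ℕ, M + 1 ≤ q → q ≤ M + S.card →
      ‖∑ a ∈ S, ((g a : ℂ) * Complex.exp (-(Complex.I * t)) ^ a) *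
        (Complex.exp (-(Complex.I * θ)) ^ a) ^ q‖ ≤ C := by
    intro q hq1 hq2
    obtain ⟨j, rfl⟩ : ∃ j, q = M + 1 + j := ⟨q - (M + 1), by omega⟩
    have hj : (j : ℝ) ≤ m := by exact_mod_cast (by omega : j ≤ m)
    set x : ℝ := t + (M + 1 + j : ℕ) * θ with hx
    have hxpi : x - Real.pi = j * θ := by
      rw [hx, hθ]
      push_cast
      field_simp
      ring
    have hsq : (x - Real.pi) ^ 2 / 8 ≤ (m : ℝ) / (2 * k) := by
      have h1 : (Real.pi - t) ^ 2 ≤ Real.pi ^ 2 := by nlinarith [ht.1, ht.2]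
      have h2 : Real.pi ^ 2 * (m * k) ≤ 4 * (M + 1) ^ 2 := by
        have := pow_le_pow_left₀ (by positivity) hM1.le 2
        rw [div_pow, mul_pow, Real.sq_sqrt (by positivity)] at this
        linarith
      have h3 : (j : ℝ) ^ 2 ≤ m ^ 2 := by gcongr
      rw [hxpi, hθ, mul_pow, div_pow, ← mul_div_assoc, div_div, div_le_div_iff₀ (by positivity)
        (by positivity)]
      have hm0 : (0 : ℝ) ≤ m := by positivity
      calc (j : ℝ) ^ 2 * (Real.pi - t) ^ 2 * (2 * k) ≤ m ^ 2 * Real.pi ^ 2 * (2 * k) := by gcongr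
        _ = 2 * m * (Real.pi ^ 2 * (m * k)) := by ring
        _ ≤ 2 * m * (4 * (M + 1) ^ 2) := by gcongr
        _ = _ := by ring
    have hsum : ∑ a ∈ S, ((g a : ℂ) * Complex.exp (-(Complex.I * t)) ^ a) *
        (Complex.exp (-(Complex.I * θ)) ^ a) ^ (M + 1 + j) =
        ∑ a ∈ S, (g a : ℂ) * Complex.exp (-(Complex.I * x)) ^ a := by
      refine Finset.sum_congr rfl fun a _ => ?_
      rw [mul_assoc, ← Complex.exp_int_mul, ← Complex.exp_int_mul, ← Complex.exp_int_mul,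
        ← Complex.exp_nat_mul, ← Complex.exp_add]
      congr 2
      rw [hx]
      push_cast
      ring
    have hw : ‖Complex.exp (-(Complex.I * x))‖ = 1 := by
      rw [show -(Complex.I * x) = ((-x : ℝ) : ℂ) * Complex.I by push_cast; ring]
      exact Complex.norm_exp_ofReal_mul_I _
    have hlow : 2 ^ k * Real.exp (-m) ≤ ‖(Complex.exp (-(Complex.I * x)))⁻¹ - 1‖ ^ k := by
      have hhalf : (m : ℝ) / (2 * k) ≤ 1 := by
        rw [div_le_one (by positivity)]
        linarith
      calc 2 ^ k * Real.exp (-m) ≤ 2 ^ k * (1 - (m : ℝ) / (2 * k)) ^ k := by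
            gcongr
            exact exp_neg_le_one_sub_pow hk0 (by omega)
        _ = (2 * (1 - (m : ℝ) / (2 * k))) ^ k := (mul_pow _ _ _).symm
        _ ≤ _ := by
            refine pow_le_pow_left₀ (by linarith) (le_trans ?_
              (two_mul_one_sub_le_norm_exp_sub_one x)) k
            linarith
    rw [hsum, hC, le_div_iff₀ (by positivity), mul_comm]
    exact (mul_le_mul_of_nonneg_right hlow (norm_nonneg _)).trans
      (norm_pow_mul_norm_sum_le k hg hw)
  have hz : ∀ a : ℤ, ‖Complex.exp (-(Complex.I * θ)) ^ a‖ = 1 := by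
    intro a
    rw [norm_zpow, show -(Complex.I * θ) = ((-θ : ℝ) : ℂ) * Complex.I by push_cast; ring,
      Complex.norm_exp_ofReal_mul_I, one_zpow]
  have hturan := htG.trans (norm_sum_le_of_window S hS _ hz _ M C hwindow)
  rw [hm, Nat.add_sub_cancel] at hturan
  set Q : ℝ := ((M + (m + 1) : ℕ) : ℝ) with hQ
  set X : ℝ := 1 / Real.sqrt (2 * k) * (Real.sqrt m / (7 * Real.pi * Real.exp (3 / 2))) with hX
  set Y : ℝ := 2 * Real.exp 2 * Q / m with hY
  have hX0 : 0 ≤ X := by positivity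
  have hY0 : 0 ≤ Y := by positivity
  have hXY : 2 * X * Y ≤ 1 := by
    rcases Nat.eq_zero_or_pos m with h0 | h0
    -- For a single node, division by zero makes `Y = 0`; this is harmless since `X` and `Y` enter
    -- only through their `m`-th powers.
    · rw [hY, h0]
      simp
    · have hm1 : (1 : ℝ) ≤ m := by exact_mod_cast h0
      refine two_mul_ratio_mul_le_one hm1 hk' ?_
      -- Since `m + 1 ≤ 2m`, this accounts for the `2` in `π/2 + 2`; the `π/2` comes from `M`.
      have h1 : (m : ℝ) ≤ Real.sqrt (m * k) := Real.le_sqrt_of_sq_le (by nlinarith)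
      rw [hQ]
      push_cast
      linarith
  have hLY : 2 ^ k ≤ Y ^ m * L := by
    have h1 := hturan.trans (mul_le_mul_of_nonneg_right (mul_le_mul_of_nonneg_left
      (choose_le_exp_mul_div_pow (M + (m + 1)) m) (by positivity))
      (by positivity : 0 ≤ C))
    have h2 : (2 : ℝ) ^ m * (Real.exp 1 * Q / m) ^ m * C = Y ^ m * L / 2 ^ k := by
      rw [hC, hY, Real.exp_neg, ← mul_pow, show (2 : ℝ) = 1 + 1 by norm_num, Real.exp_add,
        show ((m : ℝ)) = m * 1 by ring, Real.exp_nat_mul, mul_one]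
      rw [show (1 + 1) * (Real.exp 1 * Real.exp 1) * Q / (m : ℝ) =
        ((1 + 1) * (Real.exp 1 * Q / m)) * Real.exp 1 by ring, mul_pow _ (Real.exp 1)]
      field_simp
    rw [h2, le_div_iff₀ (by positivity), one_mul] at h1
    exact h1
  have hfinal : 2 ^ k * (2 * X) ^ m ≤ L := by
    calc 2 ^ k * (2 * X) ^ m ≤ Y ^ m * L * (2 * X) ^ m := by gcongr
      _ = (2 * X * Y) ^ m * L := by rw [mul_pow _ Y]; ring
      _ ≤ 1 * L := by
          gcongr
          exact pow_le_one₀ (by positivity) hXY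
      _ = L := one_mul L
  have hpow : (2 : ℝ) ^ ((k : ℝ) - 1 - (((m + 1 : ℕ) : ℝ) - 1) / 2 * Real.logb 2 (2 * (k : ℝ))) =
      2 ^ k / 2 * (1 / Real.sqrt (2 * k)) ^ m := by
    have h2k : (0 : ℝ) < 2 * k := by positivity
    rw [Real.rpow_sub two_pos, Real.rpow_sub two_pos, Real.rpow_natCast, Real.rpow_one,
      mul_comm _ (Real.logb _ _), Real.rpow_mul two_pos.le,
      Real.rpow_logb two_pos (by norm_num) h2k, one_div, inv_pow, div_eq_mul_inv (_ / _)]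
    congr 2
    rw [Real.sqrt_eq_rpow, ← Real.rpow_natCast, ← Real.rpow_mul h2k.le]
    congr 1
    push_cast
    ring
  -- The spare factor 2 per node in `hXY` pays for the factor `|S| = m + 1` required by the Hölder
  -- step.
  have hm2 : ((m + 1 : ℕ) : ℝ) ≤ 2 ^ m := by exact_mod_cast Nat.lt_two_pow_self
  rw [hpow, Nat.add_sub_cancel, show ((m + 1 : ℕ) : ℝ) - 1 = m by push_cast; ring]
  calc 2 ^ k / 2 * (1 / Real.sqrt (2 * k)) ^ m *
        (Real.sqrt m / (7 * Real.pi * Real.exp (3 / 2))) ^ m * ((m + 1 : ℕ) : ℝ)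
      = 2 ^ k / 2 * X ^ m * ((m + 1 : ℕ) : ℝ) := by rw [hX, mul_pow]; ring
    _ ≤ 2 ^ k * X ^ m * 2 ^ m := by
        gcongr
        exact half_le_self (by positivity)
    _ = 2 ^ k * (2 * X) ^ m := by rw [mul_pow 2 X]; ring
    _ ≤ L := hfinal

/-! ### Boundaries, jumps and the conclusion. -/

/-- The points `n` of `A` with `n + 1 ∉ A`. -/
def rightBoundary (A : Finset ℤ) : Finset ℤ :=
  A.filter (fun n => n + 1 ∉ A)

/-- Translation by 1 matches the points of `A` having a left neighbour in `A` with those having a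
right neighbour, so the complements in `A` are equinumerous. -/
theorem card_rightBoundary (A : Finset ℤ) : (rightBoundary A).card = (leftBoundary A).card := by
  have h1 := Finset.card_filter_add_card_filter_not (s := A) (fun n => n - 1 ∈ A)
  have h2 := Finset.card_filter_add_card_filter_not (s := A) (fun n => n + 1 ∈ A)
  have h3 : (A.filter (fun n => n - 1 ∈ A)).card = (A.filter (fun n => n + 1 ∈ A)).card :=
    Finset.card_nbij' (fun n => n - 1) (fun n => n + 1)
      (by intro n; simp +contextual) (by intro n; simp +contextual)
      (by intro n; simp) (by intro n; simp)
  simp only [rightBoundary, leftBoundary]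
  omega

/-- The support of the forward difference of the characteristic function of `A`. -/
def jumpSet (A : Finset ℤ) : Finset ℤ :=
  (leftBoundary A).image (fun n => n - 1) ∪ rightBoundary A

theorem card_jumpSet (A : Finset ℤ) : (jumpSet A).card = 2 * (leftBoundary A).card := by
  rw [jumpSet, Finset.card_union_of_disjoint, card_rightBoundary,
    Finset.card_image_of_injective _ (sub_left_injective), two_mul]
  rw [Finset.disjoint_left]
  intro n hn hn'
  obtain ⟨a, ha, rfl⟩ := Finset.mem_image.1 hn
  exact (Finset.mem_filter.1 ha).2 (Finset.mem_filter.1 hn').1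

theorem support_fwdDiff_charFn_subset (A : Finset ℤ) :
    Function.support (fwdDiff 1 (charFn A)) ⊆ jumpSet A := by
  intro n hn
  simp only [jumpSet, leftBoundary, rightBoundary, Finset.coe_union, Finset.coe_image,
    Set.mem_union, Set.mem_image, Finset.mem_coe, Finset.mem_filter]
  by_cases h1 : n ∈ A <;> by_cases h2 : n + 1 ∈ A
  · simp [fwdDiff, charFn, h1, h2] at hn
  · exact Or.inr ⟨h1, h2⟩
  · exact Or.inl ⟨n + 1, ⟨h2, by simpa using h1⟩, by ring⟩
  · simp [fwdDiff, charFn, h1, h2] at hn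

theorem theorem3 :
    (∀ N : ℕ, ∃ K : ℕ, ∀ A : Finset ℤ, A.Nonempty → A.card = N →
      ∀ p p' : ℝ≥0∞, 1 ≤ p → p.HolderConjugate p' →
      ∀ k : ℕ, K ≤ k →
        ENNReal.ofReal
          ((2 : ℝ) ^ ((k : ℝ) - 1 - ((A.card : ℝ) - 1) / 2 * Real.logb 2 (2 * (k : ℝ))) *
            (Real.sqrt ((A.card : ℝ) - 1) / (7 * Real.pi * Real.exp (3 / 2))) ^ (A.card - 1) *
            ((k : ℝ) + 1) ^ (-(1 / p').toReal) *
            (A.card : ℝ) ^ (1 / p).toReal)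
          ≤ ellNorm p (discreteDeriv k (charFn A))) ∧
    (∀ M : ℕ, ∃ K : ℕ, ∀ A : Finset ℤ, A.Nonempty → (leftBoundary A).card = M →
      ∀ p p' : ℝ≥0∞, 1 ≤ p → p.HolderConjugate p' →
      ∀ k : ℕ, K ≤ k →
        ENNReal.ofReal
          ((2 : ℝ) ^ ((k : ℝ) - 1 -
              (2 * ((leftBoundary A).card : ℝ) - 1) / 2 * Real.logb 2 (2 * (k : ℝ))) *
            (Real.sqrt (2 * ((leftBoundary A).card : ℝ) - 1) /
              (7 * Real.pi * Real.exp (3 / 2))) ^ (2 * (leftBoundary A).card - 1) *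
            ((k : ℝ) + 1) ^ (-(1 / p').toReal) *
            (2 * ((leftBoundary A).card : ℝ)) ^ (1 / p).toReal)
          ≤ ellNorm p (discreteDeriv (k + 1) (charFn A))) := by
  constructor
  · intro N
    refine ⟨N, fun A hA hN p p' hp h k hk => ?_⟩
    obtain ⟨n, hn⟩ := hA
    exact ofReal_le_ellNorm_discreteDeriv Set.support_indicator_subset hn
      (by simp [hn]) hp h (hN ▸ hk)
  · intro M
    refine ⟨2 * M, fun A hA hM p p' hp h k hk => ?_⟩
    -- The maximum of `A` is a right boundary point, where the first difference equals `-1`; it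
    -- supplies the coefficient of modulus at least 1.
    have hmax : A.max' hA + 1 ∉ A := fun hmem => by
      have := A.le_max' _ hmem
      omega
    have hmem := A.max'_mem hA
    have := ofReal_le_ellNorm_discreteDeriv (support_fwdDiff_charFn_subset A)
      (n := A.max' hA)
      (Finset.mem_union_right _ (Finset.mem_filter.2 ⟨hmem, hmax⟩))
      (by simp [fwdDiff, charFn, hmem, hmax]) hp h (k := k) (by rw [card_jumpSet, hM]; exact hk)
    rw [card_jumpSet] at this
    rw [discreteDeriv_succ]
    push_cast at this
    exact this
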